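/- A word $w$ over a finite alphabet $V$ \emph{word-represents} a simple graph $G=(V,E)$ if every letter of $V$ occurs in $w$ and, for all distinct $x,y\in V$, $xy\in E$ if and only if $x$ and $y$ alternate in $w$, that is, the word obtained from $w$ by deleting all letters other than $x$ and $y$ has no two equal consecutive letters. Let $\ell(G)$ denote the minimal length of a word that word-represents $G$, and let $n(G)$ denote the number of words of length $\ell(G)$ that word-represent $G$. Theorem. Let $T=(V,E)$ be a finite tree with at least two vertices. Then $$n(T) = 2\,\prod_{v\in V}\deg(v)!\;\cdot\sum_{xy\in E}\frac{1}{\deg(x)\deg(y)},$$ where $\deg(v)$ denotes the degree of $v$ in $T$, and the sum is over the (unordered) edges of $T$. -/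

import Mathlib

namespace WordRep

/-- The letters `x` and `y` alternate in the word `w`: in the restriction of `w` to the letters
`x`, `y` no two consecutive letters are equal. -/
def Alternate {V : Type*} [DecidableEq V] (w : List V) (x y : V) : Prop :=
  (w.filter (fun z => z = x ∨ z = y)).IsChain (· ≠ ·)

/-- The word `w` word-represents the graph `G`: every vertex occurs in `w`, and two distinct
vertices are adjacent if and only if they alternate in `w`. -/
def Represents {V : Type*} [DecidableEq V] (w : List V) (G : SimpleGraph V) : Prop :=
  (∀ v : V, v ∈ w) ∧ ∀ x y : V, x ≠ y → (G.Adj x y ↔ Alternate w x y)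

/-- `ℓ(G)`: the minimal length of a word that word-represents `G`
(meaningful for word-representable `G`). -/
noncomputable def minLength {V : Type*} [DecidableEq V] (G : SimpleGraph V) : ℕ :=
  sInf {k : ℕ | ∃ w : List V, Represents w G ∧ w.length = k}

/-- `n(G)`: the number of words of length `ℓ(G)` that word-represent `G`. -/
noncomputable def numMinRepresentants {V : Type*} [DecidableEq V] (G : SimpleGraph V) : ℕ :=
  {w : List V | Represents w G ∧ w.length = minLength G}.ncard

/-- The summand `1 / (deg x * deg y)` attached to the unordered pair `xy`. -/
def edgeTerm {V : Type*} [Fintype V] (G : SimpleGraph V) [DecidableRel G.Adj] : Sym2 V → ℚ :=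
  Sym2.lift ⟨fun x y => 1 / ((G.degree x : ℚ) * (G.degree y : ℚ)),
    fun x y => by simp only [mul_comm]⟩

end WordRep

/-! Two letters that each occur once always alternate, so the letters occurring once form a clique.
A tree has no triangle, hence at most two letters occur once and a representing word has length at
least `2|V| - 2`. Equality forces exactly two such letters, joined by an edge `e`, and every other
letter to occur twice. The words are therefore counted separately for each `e`.

For fixed `e = xy`, start from the words `xy`, `yx` and grow the tree leaf by leaf. A leaf `l`
attached to `p` is inserted twice, and it alternates with exactly `p` iff the factor enclosed by its
two copies contains `p` an odd number of times and every other letter an even number of times: a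
unit factor for `p`. The invariant in `IsCounted` says that the number of unit factors for `q`
depends only on the current degree of `q`. It survives insertion because unit factors do not cross
(`IsUnitFactor.not_crossing`): each old one persists, except that the chosen one splits in two, with
or without the new letters. So `p` contributes choices `1, 2, 3, ...` as its neighbours off `e`
arrive, giving `2 ∏ inDegree!` words. As `inDegree` is the degree, less one at the ends of `e`, this
equals `2 ∏ deg! / (deg x deg y)`. -/

namespace WordRep

set_option linter.unusedSectionVars false

/-! ### Inserting a letter twice into a word -/

section Words

variable {V : Type*} [DecidableEq V]

/-- The number of occurrences of `z` among the first `i` letters of `w`. -/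
def prefixCount (w : List V) (i : ℕ) (z : V) : ℕ := (w.take i).count z

lemma prefixCount_mono (w : List V) (z : V) {i j : ℕ} (h : i ≤ j) :
    prefixCount w i z ≤ prefixCount w j z :=
  (List.take_sublist_take_left h).count_le z

lemma prefixCount_le_count (w : List V) (i : ℕ) (z : V) : prefixCount w i z ≤ w.count z :=
  (List.take_sublist i w).count_le z

lemma prefixCount_eq_zero {w : List V} {z : V} (hz : z ∉ w) (i : ℕ) : prefixCount w i z = 0 :=
  List.count_eq_zero_of_not_mem fun h => hz (List.mem_of_mem_take h)

/-- The word obtained from `w` by inserting the letter `l` into the gaps `a ≤ b`. -/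
def insertTwice (l : V) (w : List V) (a b : ℕ) : List V := (w.insertIdx b l).insertIdx a l

lemma insertIdx_length_append (l : V) (A B : List V) :
    (A ++ B).insertIdx A.length l = A ++ l :: B := by
  induction A with
  | nil => simp
  | cons x A ih => simp [ih]

lemma insertTwice_append (l : V) (A F C : List V) :
    insertTwice l (A ++ (F ++ C)) A.length (A.length + F.length) =
      A ++ l :: (F ++ l :: C) := by
  have h := insertIdx_length_append l (A ++ F) C
  rw [List.length_append, List.append_assoc, List.append_assoc] at h
  rw [insertTwice, h, insertIdx_length_append]

lemma prefixCount_insertIdx (l : V) (w : List V) {k : ℕ} (hk : k ≤ w.length) (i : ℕ) (z : V) :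
    prefixCount (w.insertIdx k l) i z =
      if i ≤ k then prefixCount w i z
      else prefixCount w (i - 1) z + if z = l then 1 else 0 := by
  obtain ⟨A, B, rfl, rfl⟩ : ∃ A B, w = A ++ B ∧ k = A.length :=
    ⟨w.take k, w.drop k, by simp, by simp [hk]⟩
  rw [insertIdx_length_append]
  split_ifs with h hz
  · simp [prefixCount, List.take_append, Nat.sub_eq_zero_of_le h]
  · obtain ⟨j, rfl⟩ : ∃ j, i = A.length + j + 1 := ⟨i - A.length - 1, by omega⟩
    subst hz
    simp [prefixCount, List.take_append, List.take_of_length_le, Nat.add_assoc]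
  · obtain ⟨j, rfl⟩ : ∃ j, i = A.length + j + 1 := ⟨i - A.length - 1, by omega⟩
    simp [prefixCount, List.take_append, List.take_of_length_le, Nat.add_assoc,
      List.count_cons_of_ne (Ne.symm hz)]

/-- The gap of `w` lying under the gap `i` of `insertTwice l w a b`. -/
def underGap (a b i : ℕ) : ℕ := if i ≤ a then i else if i ≤ b + 1 then i - 1 else i - 2

lemma length_insertTwice (l : V) {w : List V} {a b : ℕ} (hab : a ≤ b) (hb : b ≤ w.length) :
    (insertTwice l w a b).length = w.length + 2 := by
  rw [insertTwice, List.length_insertIdx_of_le_length, List.length_insertIdx_of_le_length hb]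
  rw [List.length_insertIdx_of_le_length hb]; omega

lemma prefixCount_insertTwice_of_ne {l : V} {w : List V} {a b : ℕ} (hab : a ≤ b)
    (hb : b ≤ w.length) (i : ℕ) {z : V} (hz : z ≠ l) :
    prefixCount (insertTwice l w a b) i z = prefixCount w (underGap a b i) z := by
  have h1 : a ≤ (w.insertIdx b l).length := by
    rw [List.length_insertIdx_of_le_length hb]; omega
  rw [insertTwice, prefixCount_insertIdx l _ h1, prefixCount_insertIdx l _ hb,
    prefixCount_insertIdx l _ hb, underGap]
  simp only [hz, if_false, add_zero]
  split_ifs <;> first | rfl | omega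

lemma prefixCount_insertTwice_self {l : V} {w : List V} {a b : ℕ} (hab : a ≤ b)
    (hb : b ≤ w.length) (hl : l ∉ w) (i : ℕ) :
    prefixCount (insertTwice l w a b) i l =
      if i ≤ a then 0 else if i ≤ b + 1 then 1 else 2 := by
  have h1 : a ≤ (w.insertIdx b l).length := by
    rw [List.length_insertIdx_of_le_length hb]; omega
  rw [insertTwice, prefixCount_insertIdx l _ h1, prefixCount_insertIdx l _ hb,
    prefixCount_insertIdx l _ hb]
  simp only [prefixCount_eq_zero hl, if_true]
  split_ifs <;> omega

lemma exists_eq_insertTwice {l : V} {w : List V} (h : w.count l = 2) :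
    ∃ w' a b, l ∉ w' ∧ a ≤ b ∧ b ≤ w'.length ∧ w = insertTwice l w' a b := by
  obtain ⟨A, B, rfl, hA⟩ := List.eq_append_cons_of_mem
    (List.count_pos_iff.1 (by omega : 0 < w.count l))
  rw [List.count_append, List.count_cons_self, List.count_eq_zero_of_not_mem hA] at h
  obtain ⟨F, C, rfl, hF⟩ := List.eq_append_cons_of_mem
    (List.count_pos_iff.1 (by omega : 0 < B.count l))
  rw [List.count_append, List.count_cons_self, List.count_eq_zero_of_not_mem hF] at h
  have hC : l ∉ C := List.count_eq_zero.1 (by omega)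
  exact ⟨A ++ (F ++ C), A.length, A.length + F.length, by simp [hA, hF, hC], by omega,
    by simp, (insertTwice_append l A F C).symm⟩

lemma exists_append_append {w : List V} {a b : ℕ} (hab : a ≤ b) (hb : b ≤ w.length) :
    ∃ A F C, w = A ++ (F ++ C) ∧ a = A.length ∧ b = A.length + F.length := by
  refine ⟨w.take a, (w.drop a).take (b - a), (w.drop a).drop (b - a), ?_, ?_, ?_⟩
  · rw [List.take_append_drop, List.take_append_drop]
  · simp; omega
  · simp; omega

lemma prefixCount_length (w : List V) (z : V) : prefixCount w w.length z = w.count z := by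
  simp [prefixCount]

lemma count_insertTwice_self {l : V} {w : List V} {a b : ℕ} (hab : a ≤ b)
    (hb : b ≤ w.length) (hl : l ∉ w) : (insertTwice l w a b).count l = 2 := by
  rw [← prefixCount_length, prefixCount_insertTwice_self hab hb hl, length_insertTwice l hab hb]
  split_ifs <;> omega

lemma filter_insertTwice {l : V} {w : List V} {a b : ℕ} (hab : a ≤ b)
    (hb : b ≤ w.length) (P : V → Bool) (hP : P l = false) :
    (insertTwice l w a b).filter P = w.filter P := by
  obtain ⟨A, F, C, rfl, rfl, rfl⟩ := exists_append_append hab hb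
  simp [insertTwice_append, hP]

lemma count_insertTwice_of_ne {l : V} {w : List V} {a b : ℕ} (hab : a ≤ b)
    (hb : b ≤ w.length) {z : V} (hz : z ≠ l) : (insertTwice l w a b).count z = w.count z := by
  obtain ⟨A, F, C, rfl, rfl, rfl⟩ := exists_append_append hab hb
  simp [insertTwice_append, List.count_cons_of_ne (Ne.symm hz)]

lemma insertTwice_injective {l : V} {w w' : List V} {a b a' b' : ℕ} (hl : l ∉ w) (hl' : l ∉ w')
    (hab : a ≤ b) (hb : b ≤ w.length) (hab' : a' ≤ b') (hb' : b' ≤ w'.length)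
    (h : insertTwice l w a b = insertTwice l w' a' b') : w = w' ∧ a = a' ∧ b = b' := by
  obtain ⟨A, F, C, rfl, rfl, rfl⟩ := exists_append_append hab hb
  obtain ⟨A', F', C', rfl, rfl, rfl⟩ := exists_append_append hab' hb'
  simp only [List.mem_append, not_or] at hl hl'
  rw [insertTwice_append, insertTwice_append] at h
  have key : ∀ X Y X' Y' : List V, l ∉ X → l ∉ X' → X ++ l :: Y = X' ++ l :: Y' →
      X = X' ∧ Y = Y' := by
    intro X
    induction X with
    | nil =>
      rintro Y (_ | ⟨x, X'⟩) Y' _ h' e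
      · simpa using e
      · simp at e h'; exact absurd e.1 h'.1
    | cons x X ih =>
      rintro Y (_ | ⟨x', X'⟩) Y' h h' e
      · simp at e h; exact absurd e.1.symm h.1
      · simp only [List.mem_cons, not_or] at h h'
        simp only [List.cons_append, List.cons.injEq] at e
        obtain ⟨rfl, rfl⟩ := ih _ _ _ h.2 h'.2 e.2
        exact ⟨by rw [e.1], rfl⟩
  obtain ⟨rfl, h₁⟩ := key _ _ _ _ hl.1 hl'.1 h
  obtain ⟨rfl, rfl⟩ := key _ _ _ _ hl.2.1 hl'.2.1 h₁
  exact ⟨rfl, rfl, rfl⟩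

lemma alternate_comm (w : List V) (x y : V) : Alternate w x y ↔ Alternate w y x := by
  simp only [Alternate, or_comm]

lemma alternate_insertTwice_of_ne {l : V} {w : List V} {a b : ℕ} (hab : a ≤ b)
    (hb : b ≤ w.length) {x y : V} (hx : x ≠ l) (hy : y ≠ l) :
    Alternate (insertTwice l w a b) x y ↔ Alternate w x y := by
  rw [Alternate, filter_insertTwice hab hb _ (by simp [hx.symm, hy.symm]), Alternate]

/-- Alternation needs exactly one `z` between the two copies of `l`; since `z` occurs at most twice,
one inside leaves at most one outside, so no repetition arises there. The sum of prefix counts has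
the parity of their difference and avoids truncated subtraction. -/
lemma alternate_insertTwice {l : V} {w : List V} {a b : ℕ} (hab : a ≤ b) (hb : b ≤ w.length)
    (hl : l ∉ w) {z : V} (hz : z ≠ l) (hc : w.count z ≤ 2) :
    Alternate (insertTwice l w a b) l z ↔ (prefixCount w a z + prefixCount w b z) % 2 = 1 := by
  obtain ⟨A, F, C, rfl, rfl, rfl⟩ := exists_append_append hab hb
  simp only [List.mem_append, not_or] at hl
  have hf : ∀ X : List V, l ∉ X →
      X.filter (fun t => decide (t = l ∨ t = z)) = List.replicate (X.count z) z := by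
    intro X hX
    rw [← List.filter_eq]
    apply List.filter_congr
    intro t ht
    have : t ≠ l := fun h => hX (h ▸ ht)
    simp [this]
  have ha : prefixCount (A ++ (F ++ C)) A.length z = A.count z := by simp [prefixCount]
  have hb : prefixCount (A ++ (F ++ C)) (A.length + F.length) z = A.count z + F.count z := by
    simp [prefixCount, List.take_append, List.take_of_length_le]
  rw [ha, hb, insertTwice_append, Alternate]
  simp only [List.filter_append, List.filter_cons, true_or, decide_true, if_true, hf _ hl.1,
    hf _ hl.2.1, hf _ hl.2.2]
  simp only [List.count_append] at hc
  generalize A.count z = n₁ at *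
  generalize F.count z = n₂ at *
  generalize C.count z = n₃ at *
  have h1 : n₁ ≤ 2 := by omega
  have h2 : n₂ ≤ 2 := by omega
  have h3 : n₃ ≤ 2 := by omega
  interval_cases n₁ <;> interval_cases n₂ <;> interval_cases n₃ <;>
    first | omega | simp [List.replicate, hz, hz.symm]

lemma alternate_of_count_eq_one {w : List V} {x y : V} (hxy : x ≠ y) (hx : w.count x = 1)
    (hy : w.count y = 1) : Alternate w x y := by
  have hp : (w.filter (fun z => decide (z = x ∨ z = y))).Perm [x, y] := by
    rw [List.perm_iff_count]
    intro z
    by_cases hzx : z = x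
    · subst hzx; rw [List.count_filter (by simp), hx]; simp [hxy.symm]
    by_cases hzy : z = y
    · subst hzy; rw [List.count_filter (by simp), hy]; simp [hxy]
    · rw [List.count_eq_zero_of_not_mem (by simp [hzx, hzy]),
        List.count_eq_zero_of_not_mem (by simp [hzx, hzy])]
  rw [Alternate]
  rcases List.perm_pair.1 hp with h | h <;> rw [h] <;> simp [hxy, hxy.symm]

end Words

/-! ### Unit factors and their behaviour under insertion -/

section UnitFactors

variable {V : Type*} [DecidableEq V]

/-- The factor of `w` between the gaps `i` and `j` contains `q` an odd number of times and every
other letter an even number of times. -/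
def IsUnitFactor (w : List V) (q : V) (i j : ℕ) : Prop :=
  ∀ z, (prefixCount w i z + prefixCount w j z) % 2 = if z = q then 1 else 0

open Classical in
/-- The factors of `w`, as pairs of gaps, that contain `q` an odd number of times and every
other letter an even number of times. -/
noncomputable def unitFactors (w : List V) (q : V) : Finset (ℕ × ℕ) :=
  (Finset.range (w.length + 1) ×ˢ Finset.range (w.length + 1)).filter
    fun g => g.1 < g.2 ∧ IsUnitFactor w q g.1 g.2

lemma mem_unitFactors {w : List V} {q : V} {i j : ℕ} :
    (i, j) ∈ unitFactors w q ↔ i < j ∧ j ≤ w.length ∧ IsUnitFactor w q i j := by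
  simp only [unitFactors, Finset.mem_filter, Finset.mem_product, Finset.mem_range]
  constructor
  · rintro ⟨⟨_, h⟩, h1, h2⟩; exact ⟨h1, by omega, h2⟩
  · rintro ⟨h, h1, h2⟩; exact ⟨⟨by omega, by omega⟩, h, h2⟩

/-- Every nonempty factor of `w` contains some letter an odd number of times. -/
def SelfAvoiding (w : List V) : Prop :=
  ∀ i j, i < j → j ≤ w.length → ∃ z, (prefixCount w i z + prefixCount w j z) % 2 = 1

/-- Unit factors do not overlap properly. -/
lemma IsUnitFactor.not_crossing {w : List V} (hw : SelfAvoiding w) (hc : ∀ z, w.count z ≤ 2)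
    {p q : V} {a b i j : ℕ} (hp : IsUnitFactor w p a b) (hq : IsUnitFactor w q i j)
    (hai : a < i) (hib : i < b) (hbj : b < j) (hj : j ≤ w.length) : False := by
  obtain ⟨z₁, h₁⟩ := hw a i hai (by omega)
  obtain ⟨z₂, h₂⟩ := hw i b hib (by omega)
  obtain ⟨z₃, h₃⟩ := hw b j hbj hj
  obtain ⟨z₄, h₄⟩ := hw a j (by omega) hj
  have bound : ∀ z, prefixCount w a z ≤ prefixCount w i z ∧
      prefixCount w i z ≤ prefixCount w b z ∧ prefixCount w b z ≤ prefixCount w j z ∧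
      prefixCount w j z ≤ 2 := fun z =>
    ⟨prefixCount_mono w z hai.le, prefixCount_mono w z hib.le, prefixCount_mono w z hbj.le,
      (prefixCount_le_count w j z).trans (hc z)⟩
  -- An odd count of such a `z` in the middle piece would force odd counts in both outer pieces,
  -- hence three occurrences. So only `p` and `q` can witness self-avoidance of the three pieces and
  -- of their union, and the parities rule this out.
  have other : ∀ z, z ≠ p → z ≠ q →
      (prefixCount w a z + prefixCount w i z) % 2 = 0 ∧
      (prefixCount w i z + prefixCount w b z) % 2 = 0 ∧
      (prefixCount w b z + prefixCount w j z) % 2 = 0 := by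
    intro z hzp hzq
    have hpz := hp z
    have hqz := hq z
    rw [if_neg hzp] at hpz
    rw [if_neg hzq] at hqz
    have := bound z
    omega
  have mem : ∀ z, (prefixCount w a z + prefixCount w i z) % 2 = 1 ∨
      (prefixCount w i z + prefixCount w b z) % 2 = 1 ∨
      (prefixCount w b z + prefixCount w j z) % 2 = 1 → z = p ∨ z = q := by
    intro z hz
    by_contra! hne
    have := other z hne.1 hne.2
    omega
  have m₁ := mem z₁ (by omega)
  have m₂ := mem z₂ (by omega)
  have m₃ := mem z₃ (by omega)
  have m₄ := mem z₄ (by omega)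
  have hpp := hp p
  have hqq := hq q
  have hpq := hp q
  have hqp := hq p
  rw [if_pos rfl] at hpp hqq
  by_cases h : p = q
  · subst h
    simp only [or_self] at m₁ m₂ m₃ m₄
    subst m₁ m₂
    omega
  · rw [if_neg (Ne.symm h)] at hpq
    rw [if_neg h] at hqp
    rcases m₁ with rfl | rfl <;> rcases m₂ with rfl | rfl <;> rcases m₃ with rfl | rfl <;>
      rcases m₄ with rfl | rfl <;> omega

section Insert

variable {l : V} {w : List V} {a b : ℕ}

/-- A gap of `insertTwice l w a b` lies between the two inserted letters. -/
def IsInner (a b i : ℕ) : Prop := a < i ∧ i ≤ b + 1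

lemma prefixCount_insertTwice_self_mod (hab : a ≤ b) (hb : b ≤ w.length) (hl : l ∉ w) (i j : ℕ) :
    (prefixCount (insertTwice l w a b) i l + prefixCount (insertTwice l w a b) j l) % 2 = 0 ↔
      (IsInner a b i ↔ IsInner a b j) := by
  rw [prefixCount_insertTwice_self hab hb hl, prefixCount_insertTwice_self hab hb hl]
  simp only [IsInner]
  split_ifs <;> grind

lemma isUnitFactor_insertTwice_of_ne (hab : a ≤ b) (hb : b ≤ w.length) (hl : l ∉ w) {q : V}
    (hq : q ≠ l) (i j : ℕ) :
    IsUnitFactor (insertTwice l w a b) q i j ↔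
      IsUnitFactor w q (underGap a b i) (underGap a b j) ∧ (IsInner a b i ↔ IsInner a b j) := by
  rw [← prefixCount_insertTwice_self_mod hab hb hl]
  constructor
  · intro h
    refine ⟨fun z => ?_, by simpa [hq.symm] using h l⟩
    by_cases hz : z = l
    · subst hz
      simp [prefixCount_eq_zero hl, hq.symm]
    · have := h z
      rwa [prefixCount_insertTwice_of_ne hab hb i hz,
        prefixCount_insertTwice_of_ne hab hb j hz] at this
  · rintro ⟨h, h'⟩ z
    by_cases hz : z = l
    · subst hz
      simpa [hq.symm] using h'
    · rw [prefixCount_insertTwice_of_ne hab hb i hz, prefixCount_insertTwice_of_ne hab hb j hz]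
      exact h z

lemma isUnitFactor_insertTwice_self (hab : a ≤ b) (hb : b ≤ w.length) (hl : l ∉ w) (i j : ℕ) :
    IsUnitFactor (insertTwice l w a b) l i j ↔
      (∀ z, (prefixCount w (underGap a b i) z + prefixCount w (underGap a b j) z) % 2 = 0) ∧
        ¬(IsInner a b i ↔ IsInner a b j) := by
  rw [← prefixCount_insertTwice_self_mod hab hb hl, ← ne_eq, Nat.mod_two_ne_zero]
  constructor
  · intro h
    refine ⟨fun z => ?_, by simpa using h l⟩
    by_cases hz : z = l
    · subst hz
      simp [prefixCount_eq_zero hl]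
    · have := h z
      rwa [prefixCount_insertTwice_of_ne hab hb i hz,
        prefixCount_insertTwice_of_ne hab hb j hz, if_neg hz] at this
  · rintro ⟨h, h'⟩ z
    by_cases hz : z = l
    · subst hz
      simpa using h'
    · rw [prefixCount_insertTwice_of_ne hab hb i hz, prefixCount_insertTwice_of_ne hab hb j hz,
        if_neg hz]
      exact h z

/-- A factor containing one copy of `l` is odd in `l`. Any other factor lies over a nonempty factor
of `w`; here `a < b` matters, since otherwise `l l` would be a factor. -/
lemma SelfAvoiding.insertTwice (hw : SelfAvoiding w) (hab : a < b) (hb : b ≤ w.length)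
    (hl : l ∉ w) : SelfAvoiding (insertTwice l w a b) := by
  intro i j hij hj
  rw [length_insertTwice l hab.le hb] at hj
  by_cases h : IsInner a b i ↔ IsInner a b j
  · have hlt : underGap a b i < underGap a b j := by
      simp only [IsInner] at h
      simp only [underGap]
      split_ifs <;> omega
    obtain ⟨z, hz⟩ := hw _ _ hlt (by simp only [underGap]; split_ifs <;> omega)
    have hzl : z ≠ l := by
      rintro rfl
      simp [prefixCount_eq_zero hl] at hz
    refine ⟨z, ?_⟩
    rwa [prefixCount_insertTwice_of_ne hab.le hb i hzl,
      prefixCount_insertTwice_of_ne hab.le hb j hzl]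
  · refine ⟨l, ?_⟩
    rwa [← prefixCount_insertTwice_self_mod hab.le hb hl, ← ne_eq, Nat.mod_two_ne_zero] at h

/-- Deleting `l` from a unit factor for `l` leaves a factor with all counts even, which is empty by
self-avoidance. Only the two single letters `l` remain. -/
lemma card_unitFactors_insertTwice_self (hw : SelfAvoiding w) (hab : a < b) (hb : b ≤ w.length)
    (hl : l ∉ w) : (unitFactors (insertTwice l w a b) l).card = 2 := by
  have : unitFactors (insertTwice l w a b) l = {(a, a + 1), (b + 1, b + 2)} := by
    ext ⟨i, j⟩
    rw [mem_unitFactors, length_insertTwice l hab.le hb,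
      isUnitFactor_insertTwice_self hab.le hb hl]
    simp only [Finset.mem_insert, Finset.mem_singleton, Prod.mk.injEq]
    constructor
    · rintro ⟨hij, hj, h, h'⟩
      have heq : underGap a b i = underGap a b j := by
        by_contra hne
        have hle : underGap a b i ≤ underGap a b j := by
          simp only [underGap]; split_ifs <;> omega
        obtain ⟨z, hz⟩ := hw _ _ (lt_of_le_of_ne hle hne)
          (by simp only [underGap]; split_ifs <;> omega)
        have := h z
        omega
      simp only [IsInner] at h'
      simp only [underGap] at heq
      split_ifs at heq <;> omega
    · intro h
      have heq : underGap a b i = underGap a b j := by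
        simp only [underGap]; split_ifs <;> omega
      refine ⟨by omega, by omega, fun z => by rw [heq]; omega, ?_⟩
      simp only [IsInner]
      omega
  rw [this, Finset.card_pair]
  simp; omega

lemma card_unitFactors_insertTwice_of_ne (hw : SelfAvoiding w) (hc : ∀ z, w.count z ≤ 2)
    {p q : V} (hpab : IsUnitFactor w p a b) (hab : a < b) (hb : b ≤ w.length) (hl : l ∉ w)
    (hq : q ≠ l) :
    (unitFactors (insertTwice l w a b) q).card =
      (unitFactors w q).card + if q = p then 1 else 0 := by
  classical
  set E := unitFactors w q with hE
  set Ein := E.filter fun g => a ≤ g.1 ∧ g.2 ≤ b with hEin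
  set Eout := E.filter fun g => (g.1 ≤ a ∨ b ≤ g.1) ∧ (g.2 ≤ a ∨ b ≤ g.2) with hEout
  let up : ℕ → ℕ := fun i => if i ≤ a then i else i + 2
  -- By non-crossing, every old unit factor lies inside `(a, b)` or has no endpoint strictly between
  -- `a` and `b`.
  have hunion : Ein ∪ Eout = E := by
    ext ⟨i, j⟩
    simp only [hEin, hEout, Finset.mem_union, Finset.mem_filter]
    refine ⟨fun h => h.elim And.left And.left, fun h => ?_⟩
    obtain ⟨hij, hj, hu⟩ := mem_unitFactors.1 h
    by_contra hne
    have hne' : ¬(a ≤ i ∧ j ≤ b) ∧ ¬((i ≤ a ∨ b ≤ i) ∧ (j ≤ a ∨ b ≤ j)) := by tauto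
    by_cases hai : a < i
    · exact hpab.not_crossing hw hc hu hai (by omega) (by omega) hj
    · exact hu.not_crossing hw hc hpab (by omega : i < a) (by omega) (by omega) hb
  -- Only `(a, b)` belongs to both classes; it lifts twice and supplies the extra unit factor.
  have hinter : (Ein ∩ Eout).card = if q = p then 1 else 0 := by
    have hsub : Ein ∩ Eout = E.filter fun g => g = (a, b) := by
      ext ⟨i, j⟩
      simp only [hEin, hEout, Finset.mem_inter, Finset.mem_filter, Prod.mk.injEq]
      constructor
      · rintro ⟨⟨h, h1⟩, -, h2⟩
        have := (mem_unitFactors.1 h).1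
        exact ⟨h, by omega⟩
      · rintro ⟨h, rfl, rfl⟩
        exact ⟨⟨h, by omega⟩, h, by omega⟩
    rw [hsub, Finset.filter_eq']
    split_ifs with h1 h2 h2
    · simp
    · have := (mem_unitFactors.1 h1).2.2 q
      rw [hpab q] at this
      simp [h2] at this
    · subst h2
      exact absurd (mem_unitFactors.2 ⟨hab, hb, hpab⟩) h1
    · simp
  have hnew : unitFactors (insertTwice l w a b) q =
      Ein.image (fun g => (g.1 + 1, g.2 + 1)) ∪ Eout.image (fun g => (up g.1, up g.2)) := by
    ext ⟨i, j⟩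
    rw [mem_unitFactors, length_insertTwice l hab.le hb,
      isUnitFactor_insertTwice_of_ne hab.le hb hl hq]
    simp only [Finset.mem_union, Finset.mem_image, hEin, hEout, Finset.mem_filter, Prod.exists,
      Prod.mk.injEq]
    constructor
    · rintro ⟨hij, hj, hu, hi⟩
      have hmem : (underGap a b i, underGap a b j) ∈ E := by
        refine mem_unitFactors.2 ⟨?_, ?_, hu⟩
        · simp only [IsInner] at hi
          simp only [underGap]; split_ifs <;> omega
        · simp only [underGap]; split_ifs <;> omega
      simp only [IsInner] at hi
      by_cases hin : a < i ∧ i ≤ b + 1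
      · refine Or.inl ⟨_, _, ⟨hmem, ?_⟩, ?_⟩ <;> simp only [underGap] <;> split_ifs <;> omega
      · refine Or.inr ⟨_, _, ⟨hmem, ?_⟩, ?_⟩ <;> simp only [underGap, up] <;> split_ifs <;> omega
    · rintro (⟨i', j', ⟨h, h1⟩, rfl, rfl⟩ | ⟨i', j', ⟨h, h1⟩, rfl, rfl⟩)
      · obtain ⟨hij, hj, hu⟩ := mem_unitFactors.1 h
        have e1 : underGap a b (i' + 1) = i' := by
          simp only [underGap]; split_ifs <;> omega
        have e2 : underGap a b (j' + 1) = j' := by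
          simp only [underGap]; split_ifs <;> omega
        rw [e1, e2]
        refine ⟨by omega, by omega, hu, ?_⟩
        simp only [IsInner]; omega
      · obtain ⟨hij, hj, hu⟩ := mem_unitFactors.1 h
        have e1 : underGap a b (up i') = i' := by
          simp only [underGap, up]; split_ifs <;> omega
        have e2 : underGap a b (up j') = j' := by
          simp only [underGap, up]; split_ifs <;> omega
        rw [e1, e2]
        refine ⟨?_, ?_, hu, ?_⟩
        · simp only [up]; split_ifs <;> omega
        · simp only [up]; split_ifs <;> omega
        · simp only [IsInner, up]; split_ifs <;> omega
  have hdisj : Disjoint (Ein.image fun g => (g.1 + 1, g.2 + 1))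
      (Eout.image fun g => (up g.1, up g.2)) := by
    rw [Finset.disjoint_left]
    rintro ⟨i, j⟩ h1 h2
    simp only [Finset.mem_image, hEin, hEout, Finset.mem_filter, Prod.exists,
      Prod.mk.injEq] at h1 h2
    obtain ⟨i₁, j₁, ⟨h1, h1'⟩, rfl, rfl⟩ := h1
    obtain ⟨i₂, j₂, ⟨h2, h2'⟩, e, e'⟩ := h2
    have := (mem_unitFactors.1 h1).1
    have := (mem_unitFactors.1 h2).1
    simp only [up] at e e'
    split_ifs at e e' <;> omega
  rw [hnew, Finset.card_union_of_disjoint hdisj, Finset.card_image_of_injective,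
    Finset.card_image_of_injective, ← Finset.card_union_add_card_inter, hunion, hinter]
  · rintro ⟨i, j⟩ ⟨i', j'⟩ h
    simp only [Prod.mk.injEq, up] at h ⊢
    obtain ⟨h1, h2⟩ := h
    constructor
    · split_ifs at h1 <;> omega
    · split_ifs at h2 <;> omega
  · rintro ⟨i, j⟩ ⟨i', j'⟩ h
    simp only [Prod.mk.injEq] at h ⊢
    omega

end Insert

end UnitFactors

/-! ### Attaching a leaf and counting words for a fixed edge -/

section Growth

variable {V : Type*} [DecidableEq V]

/-- The word `w` uses the letters of `s`, those on the edge `e` once and the others twice, and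
represents the graph induced by `T` on `s`. -/
structure IsRepOn (T : SimpleGraph V) (e : Sym2 V) (s : Finset V) (w : List V) : Prop where
  count_eq : ∀ v, w.count v = if v ∈ s then (if v ∈ e then 1 else 2) else 0
  adj_iff : ∀ u ∈ s, ∀ v ∈ s, u ≠ v → (T.Adj u v ↔ Alternate w u v)

lemma IsRepOn.count_le_two {T : SimpleGraph V} {e : Sym2 V} {s : Finset V} {w : List V}
    (h : IsRepOn T e s w) (v : V) : w.count v ≤ 2 := by
  rw [h.count_eq]; split_ifs <;> omega

lemma IsRepOn.notMem {T : SimpleGraph V} {e : Sym2 V} {s : Finset V} {w : List V}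
    (h : IsRepOn T e s w) {v : V} (hv : v ∉ s) : v ∉ w := by
  have := h.count_eq v
  rw [if_neg hv] at this
  exact List.count_eq_zero.1 this

/-- The number of neighbours of `q` in `s` along edges other than `e`. -/
def inDegree (T : SimpleGraph V) [DecidableRel T.Adj] (e : Sym2 V) (s : Finset V) (q : V) : ℕ :=
  (s.filter fun u => T.Adj q u ∧ s(q, u) ≠ e).card

lemma isRepOn_insertTwice_iff {T : SimpleGraph V} {e : Sym2 V} {s : Finset V} {l p : V}
    (hl : l ∉ s) (hle : l ∉ e) (hp : p ∈ s) (hadj : ∀ q ∈ s, T.Adj l q ↔ q = p)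
    {w : List V} (hlw : l ∉ w) {a b : ℕ} (hab : a ≤ b) (hb : b ≤ w.length) :
    IsRepOn T e (insert l s) (insertTwice l w a b) ↔ IsRepOn T e s w ∧ IsUnitFactor w p a b := by
  have hne : ∀ v ∈ s, v ≠ l := fun v hv h => hl (h ▸ hv)
  constructor
  · intro h
    have hrep : IsRepOn T e s w := by
      refine ⟨fun v => ?_, fun u hu v hv huv => ?_⟩
      · by_cases hv : v = l
        · subst hv
          rw [if_neg hl, List.count_eq_zero_of_not_mem hlw]
        · have := h.count_eq v
          rw [count_insertTwice_of_ne hab hb hv] at this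
          simpa [hv] using this
      · rw [h.adj_iff u (Finset.mem_insert_of_mem hu) v (Finset.mem_insert_of_mem hv) huv,
          alternate_insertTwice_of_ne hab hb (hne u hu) (hne v hv)]
    refine ⟨hrep, fun z => ?_⟩
    by_cases hz : z ∈ s
    · have := h.adj_iff l (Finset.mem_insert_self _ _) z (Finset.mem_insert_of_mem hz)
        (hne z hz).symm
      rw [hadj z hz, alternate_insertTwice hab hb hlw (hne z hz) (hrep.count_le_two z)] at this
      split_ifs with hzp
      · exact this.1 hzp
      · have := mt this.2 hzp
        omega
    · have hzp : z ≠ p := fun h => hz (h ▸ hp)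
      simp [prefixCount_eq_zero (hrep.notMem hz), hzp]
  · rintro ⟨h, hu⟩
    have key : ∀ z ∈ s, (T.Adj l z ↔ Alternate (insertTwice l w a b) l z) := by
      intro z hz
      rw [hadj z hz, alternate_insertTwice hab hb hlw (hne z hz) (h.count_le_two z), hu z]
      simp
    refine ⟨fun v => ?_, fun u hu v hv huv => ?_⟩
    · by_cases hv : v = l
      · subst hv
        simp [count_insertTwice_self hab hb hlw, hle]
      · rw [count_insertTwice_of_ne hab hb hv, h.count_eq]
        simp [hv]
    · rcases Finset.mem_insert.1 hu with rfl | hu'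
      · rcases Finset.mem_insert.1 hv with rfl | hv
        · exact absurd rfl huv
        · exact key v hv
      · rcases Finset.mem_insert.1 hv with rfl | hv
        · rw [T.adj_comm, alternate_comm]
          exact key u hu'
        · rw [h.adj_iff u hu' v hv huv,
            alternate_insertTwice_of_ne hab hb (hne u hu') (hne v hv)]

variable {T : SimpleGraph V} [DecidableRel T.Adj] {e : Sym2 V} {s : Finset V}

lemma inDegree_insert {l p q : V} (hl : l ∉ s) (hle : l ∉ e)
    (hadj : ∀ q ∈ s, T.Adj l q ↔ q = p) (hq : q ∈ s) :
    inDegree T e (insert l s) q = inDegree T e s q + if q = p then 1 else 0 := by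
  rw [inDegree, inDegree, Finset.filter_insert]
  have hne : s(q, l) ≠ e := by
    rintro rfl
    exact hle (Sym2.mem_mk_right q l)
  have hql : T.Adj q l ↔ q = p := by rw [T.adj_comm, hadj q hq]
  by_cases h : q = p
  · rw [if_pos ⟨hql.2 h, hne⟩, if_pos h, Finset.card_insert_of_notMem (by simp [hl])]
  · rw [if_neg (by simp [hql, h]), if_neg h, add_zero]

lemma inDegree_insert_self {l p : V} (hle : l ∉ e) (hp : p ∈ s)
    (hadj : ∀ q ∈ s, T.Adj l q ↔ q = p) : inDegree T e (insert l s) l = 1 := by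
  rw [inDegree, Finset.card_eq_one]
  refine ⟨p, ?_⟩
  ext u
  simp only [Finset.mem_filter, Finset.mem_insert, Finset.mem_singleton]
  constructor
  · rintro ⟨rfl | hu, h, -⟩
    · exact absurd h (T.loopless.irrefl _)
    · exact (hadj u hu).1 h
  · rintro rfl
    refine ⟨Or.inr hp, (hadj _ hp).2 rfl, ?_⟩
    rintro rfl
    exact hle (Sym2.mem_mk_left _ _)

variable (T e s) in
/-- The words representing `T` on `s` with the letters of `e` occurring once are counted by a
product of factorials, and each of them has one more unit factor for `q` than the number of
neighbours of `q` along edges other than `e`. -/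
def IsCounted : Prop :=
  ∃ A : Finset (List V), (∀ w, w ∈ A ↔ IsRepOn T e s w) ∧
    A.card = 2 * ∏ v ∈ s, (inDegree T e s v).factorial ∧
    ∀ w ∈ A, SelfAvoiding w ∧ ∀ q ∈ s, (unitFactors w q).card = inDegree T e s q + 1

lemma prod_inDegree_insert {l p : V} (hl : l ∉ s) (hle : l ∉ e) (hp : p ∈ s)
    (hadj : ∀ q ∈ s, T.Adj l q ↔ q = p) :
    ∏ v ∈ insert l s, (inDegree T e (insert l s) v).factorial =
      (∏ v ∈ s, (inDegree T e s v).factorial) * (inDegree T e s p + 1) := by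
  rw [Finset.prod_insert hl, inDegree_insert_self hle hp hadj, Nat.factorial_one, one_mul,
    ← Finset.mul_prod_erase s _ hp, ← Finset.mul_prod_erase s _ hp,
    inDegree_insert hl hle hadj hp, if_pos rfl, Nat.factorial_succ]
  rw [Finset.prod_congr rfl (g := fun v => (inDegree T e s v).factorial)]
  · ring
  · intro v hv
    rw [Finset.mem_erase] at hv
    rw [inDegree_insert hl hle hadj hv.2, if_neg hv.1, add_zero]

/-- Words on the larger set correspond bijectively to pairs of an old word and a unit factor for
`p`, so the count is multiplied by `inDegree T e s p + 1`. -/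
lemma IsCounted.insert {l p : V} (h : IsCounted T e s) (hl : l ∉ s) (hle : l ∉ e) (hp : p ∈ s)
    (hadj : ∀ q ∈ s, T.Adj l q ↔ q = p) : IsCounted T e (insert l s) := by
  obtain ⟨A, hA, hcard, hinv⟩ := h
  let f : (_ : List V) × (ℕ × ℕ) → List V := fun g => insertTwice l g.1 g.2.1 g.2.2
  refine ⟨(A.sigma fun w => unitFactors w p).image f, fun w => ?_, ?_, ?_⟩
  · simp only [Finset.mem_image, Finset.mem_sigma, Sigma.exists, Prod.exists, f]
    constructor
    · rintro ⟨w', a, b, ⟨hw', hab⟩, rfl⟩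
      obtain ⟨h1, h2, h3⟩ := mem_unitFactors.1 hab
      have hw' := (hA w').1 hw'
      exact (isRepOn_insertTwice_iff hl hle hp hadj (hw'.notMem hl) h1.le h2).2 ⟨hw', h3⟩
    · intro hw
      have hc : w.count l = 2 := by simpa [hle] using hw.count_eq l
      obtain ⟨w', a, b, hlw, hab, hb, rfl⟩ := exists_eq_insertTwice hc
      obtain ⟨h1, h2⟩ := (isRepOn_insertTwice_iff hl hle hp hadj hlw hab hb).1 hw
      refine ⟨w', a, b, ⟨(hA w').2 h1, mem_unitFactors.2 ⟨lt_of_le_of_ne hab ?_, hb, h2⟩⟩, rfl⟩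
      -- Equal gaps enclose an empty factor, which cannot contain `p` an odd number of times.
      rintro rfl
      have := h2 p
      rw [if_pos rfl] at this
      omega
  · rw [Finset.card_image_of_injOn, Finset.card_sigma,
      Finset.sum_const_nat (m := inDegree T e s p + 1) (fun w hw => (hinv w hw).2 p hp), hcard,
      prod_inDegree_insert hl hle hp hadj, mul_assoc]
    rintro ⟨w, a, b⟩ hw ⟨w', a', b'⟩ hw' heq
    simp only [Finset.coe_sigma, Set.mem_sigma_iff, Finset.mem_coe] at hw hw'
    obtain ⟨h1, h2, -⟩ := mem_unitFactors.1 hw.2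
    obtain ⟨h1', h2', -⟩ := mem_unitFactors.1 hw'.2
    obtain ⟨rfl, rfl, rfl⟩ := insertTwice_injective (((hA _).1 hw.1).notMem hl)
      (((hA _).1 hw'.1).notMem hl) h1.le h2 h1'.le h2' heq
    rfl
  · simp only [Finset.mem_image, Finset.mem_sigma, Sigma.exists, Prod.exists, f]
    rintro _ ⟨w, a, b, ⟨hw, hab⟩, rfl⟩
    obtain ⟨h1, h2, h3⟩ := mem_unitFactors.1 hab
    obtain ⟨hs, hu⟩ := hinv w hw
    have hw := (hA w).1 hw
    have hlw := hw.notMem hl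
    refine ⟨hs.insertTwice h1 h2 hlw, fun q hq => ?_⟩
    rcases Finset.mem_insert.1 hq with rfl | hq
    · rw [card_unitFactors_insertTwice_self hs h1 h2 hlw, inDegree_insert_self hle hp hadj]
    · rw [card_unitFactors_insertTwice_of_ne hs hw.count_le_two h3 h1 h2 hlw
        (fun h => hl (h ▸ hq)), hu q hq, inDegree_insert hl hle hadj hq]
      omega

lemma selfAvoiding_pair {x y : V} (h : x ≠ y) : SelfAvoiding [x, y] := by
  intro i j hij hj
  simp only [List.length_cons, List.length_nil] at hj
  obtain ⟨rfl, rfl⟩ | ⟨rfl, rfl⟩ | ⟨rfl, rfl⟩ :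
      (i = 0 ∧ j = 1) ∨ (i = 0 ∧ j = 2) ∨ (i = 1 ∧ j = 2) := by omega
  · exact ⟨x, by simp [prefixCount]⟩
  · exact ⟨x, by simp [prefixCount, h.symm]⟩
  · exact ⟨y, by simp [prefixCount, h]⟩

lemma card_unitFactors_pair {x y q : V} (h : x ≠ y) (hq : q = x ∨ q = y) :
    (unitFactors [x, y] q).card = 1 := by
  have h1 : IsUnitFactor [x, y] x 0 1 := fun z => by
    simp only [prefixCount, List.take, List.count_nil, List.count_singleton, beq_iff_eq]
    split_ifs <;> grind
  have h2 : IsUnitFactor [x, y] y 1 2 := fun z => by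
    simp only [prefixCount, List.take, List.count_cons, List.count_nil, beq_iff_eq]
    split_ifs <;> grind
  have h3 : ∀ q, ¬ IsUnitFactor [x, y] q 0 2 := fun q hu => by
    have hx := hu x
    have hy := hu y
    simp [prefixCount, h, h.symm] at hx hy
    exact h (hx.trans hy.symm)
  rw [Finset.card_eq_one]
  rcases hq with rfl | rfl
  · refine ⟨(0, 1), ?_⟩
    ext ⟨i, j⟩
    simp only [mem_unitFactors, List.length_cons, List.length_nil, Finset.mem_singleton,
      Prod.mk.injEq]
    constructor
    · rintro ⟨hij, hj, hu⟩
      obtain ⟨rfl, rfl⟩ | ⟨rfl, rfl⟩ | ⟨rfl, rfl⟩ :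
          (i = 0 ∧ j = 1) ∨ (i = 0 ∧ j = 2) ∨ (i = 1 ∧ j = 2) := by omega
      · simp
      · exact absurd hu (h3 _)
      · have := h2 y
        rw [hu y] at this
        simp [h.symm] at this
    · rintro ⟨rfl, rfl⟩
      exact ⟨by omega, by omega, h1⟩
  · refine ⟨(1, 2), ?_⟩
    ext ⟨i, j⟩
    simp only [mem_unitFactors, List.length_cons, List.length_nil, Finset.mem_singleton,
      Prod.mk.injEq]
    constructor
    · rintro ⟨hij, hj, hu⟩
      obtain ⟨rfl, rfl⟩ | ⟨rfl, rfl⟩ | ⟨rfl, rfl⟩ :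
          (i = 0 ∧ j = 1) ∨ (i = 0 ∧ j = 2) ∨ (i = 1 ∧ j = 2) := by omega
      · have := h1 x
        rw [hu x] at this
        simp [h] at this
      · exact absurd hu (h3 _)
      · simp
    · rintro ⟨rfl, rfl⟩
      exact ⟨by omega, by omega, h2⟩

lemma isRepOn_pair {x y : V} (hxy : T.Adj x y) : IsRepOn T s(x, y) {x, y} [x, y] := by
  have hne := hxy.ne
  refine ⟨fun v => ?_, fun u hu v hv huv => ?_⟩
  · by_cases hx : v = x
    · subst hx; simp [hne.symm]
    by_cases hy : v = y
    · subst hy; simp [hne]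
    · rw [List.count_eq_zero_of_not_mem (by simp [hx, hy]), if_neg (by simp [hx, hy])]
  · have halt : Alternate [x, y] x y :=
      alternate_of_count_eq_one hne (by simp [hne.symm]) (by simp [hne])
    simp only [Finset.mem_insert, Finset.mem_singleton] at hu hv
    rcases hu with rfl | rfl <;> rcases hv with rfl | rfl
    · exact absurd rfl huv
    · exact iff_of_true hxy halt
    · exact iff_of_true hxy.symm ((alternate_comm _ _ _).1 halt)
    · exact absurd rfl huv

lemma isCounted_pair {x y : V} (hxy : T.Adj x y) : IsCounted T s(x, y) {x, y} := by
  have hne := hxy.ne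
  have hdeg : ∀ q ∈ ({x, y} : Finset V), inDegree T s(x, y) {x, y} q = 0 := by
    intro q hq
    rw [inDegree, Finset.card_eq_zero, Finset.filter_eq_empty_iff]
    intro u hu
    simp only [Finset.mem_insert, Finset.mem_singleton] at hq hu
    rintro ⟨h1, h2⟩
    rcases hq with rfl | rfl <;> rcases hu with rfl | rfl
    · exact h1.ne rfl
    · exact h2 rfl
    · exact h2 Sym2.eq_swap
    · exact h1.ne rfl
  refine ⟨{[x, y], [y, x]}, fun w => ?_, ?_, ?_⟩
  · rw [Finset.mem_insert, Finset.mem_singleton]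
    constructor
    · rintro (rfl | rfl)
      · exact isRepOn_pair hxy
      · have := isRepOn_pair hxy.symm
        rwa [Sym2.eq_swap, Finset.pair_comm] at this
    · intro h
      rw [← List.perm_pair, List.perm_iff_count]
      intro v
      rw [h.count_eq, (isRepOn_pair hxy).count_eq]
  · rw [Finset.card_pair (by simp [hne]),
      Finset.prod_eq_one fun v hv => by rw [hdeg v hv, Nat.factorial_zero], mul_one]
  · intro w hw
    rw [Finset.mem_insert, Finset.mem_singleton] at hw
    rcases hw with rfl | rfl
    · refine ⟨selfAvoiding_pair hne, fun q hq => ?_⟩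
      rw [hdeg q hq, card_unitFactors_pair hne (by simpa using hq)]
    · refine ⟨selfAvoiding_pair hne.symm, fun q hq => ?_⟩
      rw [hdeg q hq, card_unitFactors_pair hne.symm (by simpa [or_comm] using hq)]

end Growth

/-! ### Growing the whole tree from an edge -/

section Trees

variable {V : Type*} [Fintype V] [DecidableEq V] {T : SimpleGraph V}

/-- In an acyclic graph, a vertex outside a set whose induced graph is connected has at most one
neighbour in that set. -/
lemma eq_of_adj_of_adj (hT : T.IsAcyclic) {s : Finset V}
    (hs : ∀ H : SimpleGraph V, (∀ u ∈ s, ∀ v ∈ s, T.Adj u v → H.Adj u v) →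
      ∀ u ∈ s, ∀ v ∈ s, H.Reachable u v)
    {l p q : V} (hl : l ∉ s) (hp : p ∈ s) (hq : q ∈ s) (hlp : T.Adj l p) (hlq : T.Adj l q) :
    q = p := by
  by_contra hne
  have hbridge := SimpleGraph.isAcyclic_iff_forall_isBridge.1 hT
    ((SimpleGraph.mem_edgeSet T).2 hlp)
  rw [SimpleGraph.isBridge_iff] at hbridge
  refine hbridge ?_
  have h1 : (T.deleteEdges {s(l, p)}).Adj l q := by
    rw [SimpleGraph.deleteEdges_adj]
    refine ⟨hlq, ?_⟩
    simp [hne, hlp.ne]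
  -- Connectedness of `s` is phrased for every graph `H` containing the edges of `T` within `s`, so
  -- it applies after deleting `lp`: the route from `l` to `q` and on through `s` to `p` contradicts
  -- that `lp` is a bridge.
  refine h1.reachable.trans (hs _ (fun u hu v hv huv => ?_) q hq p hp)
  rw [SimpleGraph.deleteEdges_adj]
  refine ⟨huv, ?_⟩
  have : u ≠ l := fun h => hl (h ▸ hu)
  have : v ≠ l := fun h => hl (h ▸ hv)
  simp [*]

lemma isCounted_univ [DecidableRel T.Adj] (hT : T.IsTree) {x y : V} (hxy : T.Adj x y) :
    IsCounted T s(x, y) Finset.univ := by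
  have main : ∀ n : ℕ, ∃ s : Finset V, IsCounted T s(x, y) s ∧ x ∈ s ∧ y ∈ s ∧
      (∀ H : SimpleGraph V, (∀ u ∈ s, ∀ v ∈ s, T.Adj u v → H.Adj u v) →
        ∀ u ∈ s, ∀ v ∈ s, H.Reachable u v) ∧ (s = Finset.univ ∨ n ≤ s.card) := by
    intro n
    induction n with
    | zero =>
      refine ⟨{x, y}, isCounted_pair hxy, by simp, by simp, fun H hH u hu v hv => ?_, by simp⟩
      have hr : H.Reachable x y := (hH x (by simp) y (by simp) hxy).reachable
      simp only [Finset.mem_insert, Finset.mem_singleton] at hu hv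
      rcases hu with rfl | rfl <;> rcases hv with rfl | rfl
      · rfl
      · exact hr
      · exact hr.symm
      · rfl
    | succ n ih =>
      obtain ⟨s, hc, hx, hy, hs, h⟩ := ih
      by_cases hu : s = Finset.univ
      · exact ⟨s, hc, hx, hy, hs, Or.inl hu⟩
      obtain ⟨z, hz⟩ : ∃ z, z ∉ s := by
        by_contra! hall
        exact hu (Finset.eq_univ_iff_forall.2 hall)
      obtain ⟨W⟩ := hT.connected.preconnected x z
      -- The next leaf is the outer end of an edge where a walk leaves `s`.
      obtain ⟨d, -, hd1, hd2⟩ := W.exists_boundary_dart (s : Set V) hx hz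
      have hp : d.fst ∈ s := hd1
      have hl : d.snd ∉ s := hd2
      have hlp : T.Adj d.snd d.fst := d.adj.symm
      generalize d.fst = p at hp hlp
      generalize d.snd = l at hl hlp
      have hadj : ∀ q ∈ s, T.Adj l q ↔ q = p := fun q hq =>
        ⟨eq_of_adj_of_adj hT.isAcyclic hs hl hp hq hlp, fun h => h ▸ hlp⟩
      have hle : l ∉ s(x, y) := by
        rw [Sym2.mem_iff]
        rintro (rfl | rfl)
        · exact hl hx
        · exact hl hy
      refine ⟨insert l s, hc.insert hl hle hp hadj, Finset.mem_insert_of_mem hx,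
        Finset.mem_insert_of_mem hy, fun H hH u hu v hv => ?_, Or.inr ?_⟩
      · have hr : ∀ u ∈ insert l s, H.Reachable u p := by
          intro u hu
          rcases Finset.mem_insert.1 hu with rfl | hu
          · exact (hH u (Finset.mem_insert_self _ _) p (Finset.mem_insert_of_mem hp)
              hlp).reachable
          · exact hs H (fun a ha b hb => hH a (Finset.mem_insert_of_mem ha) b
              (Finset.mem_insert_of_mem hb)) u hu p hp
        exact (hr u hu).trans (hr v hv).symm
      · rw [Finset.card_insert_of_notMem hl]
        have := h.resolve_left hu
        omega
  -- No set has this many vertices, so the growth has reached all of `V`.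
  obtain ⟨s, hc, -, -, -, h⟩ := main (Fintype.card V + 1)
  rcases h with rfl | h
  · exact hc
  · have := Finset.card_le_univ s
    omega

lemma degree_eq_inDegree_add [DecidableRel T.Adj] {e : Sym2 V} (he : e ∈ T.edgeSet) (v : V) :
    T.degree v = inDegree T e Finset.univ v + if v ∈ e then 1 else 0 := by
  rw [← SimpleGraph.card_neighborFinset_eq_degree, SimpleGraph.neighborFinset_eq_filter,
    ← Finset.card_filter_add_card_filter_not (fun u => s(v, u) ≠ e), Finset.filter_filter,
    inDegree]
  congr 1
  split_ifs with hv
  · obtain ⟨u, rfl⟩ := hv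
    rw [Finset.card_eq_one]
    refine ⟨u, ?_⟩
    ext u'
    simp only [Finset.mem_filter, Finset.mem_univ, true_and, not_not, Finset.mem_singleton,
      Sym2.congr_right]
    refine ⟨And.right, ?_⟩
    rintro rfl
    exact ⟨he, rfl⟩
  · rw [Finset.card_eq_zero, Finset.filter_eq_empty_iff]
    rintro u - h
    rw [not_not] at h
    exact hv (h ▸ Sym2.mem_mk_left v u)

lemma prod_mem_pair {M : Type*} [CommMonoid M] {x y : V} (hxy : x ≠ y) (f : V → M) :
    ∏ v, (if v ∈ s(x, y) then f v else 1) = f x * f y := by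
  rw [← Finset.prod_filter, ← Finset.prod_pair hxy]
  congr 1
  ext v
  simp

lemma two_mul_prod_inDegree [DecidableRel T.Adj] {e : Sym2 V} (he : e ∈ T.edgeSet) :
    ((2 * ∏ v, (inDegree T e Finset.univ v).factorial : ℕ) : ℚ) =
      2 * (∏ v : V, ((T.degree v).factorial : ℚ)) * edgeTerm T e := by
  have hdeg := degree_eq_inDegree_add he
  induction e with | _ x y
  have hxy : T.Adj x y := he
  have hfac : ∀ v, (T.degree v).factorial =
      (inDegree T s(x, y) Finset.univ v).factorial *
        if v ∈ s(x, y) then T.degree v else 1 := by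
    intro v
    split_ifs with hv
    · have := hdeg v
      rw [if_pos hv] at this
      rw [this, Nat.factorial_succ, mul_comm]
    · have := hdeg v
      rw [if_neg hv, add_zero] at this
      rw [this, mul_one]
  have hprod : ∏ v, (T.degree v).factorial =
      (∏ v, (inDegree T s(x, y) Finset.univ v).factorial) * (T.degree x * T.degree y) := by
    rw [Finset.prod_congr rfl fun v _ => hfac v, Finset.prod_mul_distrib,
      prod_mem_pair hxy.ne]
  have hx : (T.degree x : ℚ) ≠ 0 := by
    have := hdeg x
    rw [if_pos (Sym2.mem_mk_left x y)] at this
    exact_mod_cast (by omega : T.degree x ≠ 0)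
  have hy : (T.degree y : ℚ) ≠ 0 := by
    have := hdeg y
    rw [if_pos (Sym2.mem_mk_right x y)] at this
    exact_mod_cast (by omega : T.degree y ≠ 0)
  have hterm : edgeTerm T s(x, y) = 1 / ((T.degree x : ℚ) * (T.degree y : ℚ)) := rfl
  rw [← Nat.cast_prod, hprod, hterm]
  push_cast
  field_simp

/-! ### Minimal length and the shape of minimal words -/

lemma sum_count_eq_length (w : List V) : ∑ v, w.count v = w.length := by
  simpa using Multiset.sum_count_eq_card (s := Finset.univ) (m := (w : Multiset V)) (by simp)

lemma IsRepOn.represents {e : Sym2 V} {w : List V} (h : IsRepOn T e Finset.univ w) :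
    Represents w T := by
  refine ⟨fun v => ?_, fun x y hxy => h.adj_iff x (Finset.mem_univ _) y (Finset.mem_univ _) hxy⟩
  have := h.count_eq v
  rw [if_pos (Finset.mem_univ v)] at this
  refine List.count_pos_iff.1 ?_
  split_ifs at this <;> omega

lemma IsRepOn.length_add_two {e : Sym2 V} (he : e ∈ T.edgeSet) {w : List V}
    (h : IsRepOn T e Finset.univ w) : w.length + 2 = 2 * Fintype.card V := by
  induction e with | _ x y
  have hne : x ≠ y := SimpleGraph.Adj.ne he
  have h2 : ∑ v, (if v ∈ s(x, y) then 1 else 0) = 2 := by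
    rw [← Finset.card_filter, ← Finset.card_pair hne]
    congr 1
    ext v
    simp
  have h3 : ∑ v, (w.count v + if v ∈ s(x, y) then 1 else 0) = ∑ _v : V, 2 := by
    refine Finset.sum_congr rfl fun v _ => ?_
    rw [h.count_eq, if_pos (Finset.mem_univ v)]
    split_ifs <;> rfl
  rw [Finset.sum_add_distrib, sum_count_eq_length, h2, Finset.sum_const, Finset.card_univ,
    smul_eq_mul] at h3
  omega

lemma card_count_eq_one_le (hT : T.IsAcyclic) {w : List V} (h : Represents w T) :
    (Finset.univ.filter fun v => w.count v = 1).card ≤ 2 := by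
  by_contra! hlt
  obtain ⟨t, ht, ht3⟩ := Finset.exists_subset_card_eq (Nat.succ_le_of_lt hlt)
  refine hT.cliqueFree le_rfl t ⟨fun x hx y hy hxy => ?_, ht3⟩
  exact (h.2 x y hxy).2 (alternate_of_count_eq_one hxy (Finset.mem_filter.1 (ht hx)).2
    (Finset.mem_filter.1 (ht hy)).2)

lemma two_le_count_add {w : List V} (h : Represents w T) (v : V) :
    2 ≤ w.count v + if w.count v = 1 then 1 else 0 := by
  have := List.count_pos_iff.2 (h.1 v)
  split_ifs <;> omega

lemma sum_count_add (w : List V) :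
    ∑ v, (w.count v + if w.count v = 1 then 1 else 0) =
      w.length + (Finset.univ.filter fun v => w.count v = 1).card := by
  rw [Finset.sum_add_distrib, sum_count_eq_length, Finset.card_filter]

lemma Represents.two_mul_card_le (hT : T.IsAcyclic) {w : List V} (h : Represents w T) :
    2 * Fintype.card V ≤ w.length + 2 := by
  have h1 : ∑ _v : V, 2 ≤ ∑ v, (w.count v + if w.count v = 1 then 1 else 0) :=
    Finset.sum_le_sum fun v _ => two_le_count_add h v
  rw [sum_count_add, Finset.sum_const, Finset.card_univ, smul_eq_mul] at h1
  have := card_count_eq_one_le hT h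
  omega

lemma Represents.exists_isRepOn (hT : T.IsAcyclic) {w : List V} (h : Represents w T)
    (hw : w.length + 2 = 2 * Fintype.card V) :
    ∃ e ∈ T.edgeSet, IsRepOn T e Finset.univ w := by
  have hle : ∀ v ∈ Finset.univ, 2 ≤ w.count v + if w.count v = 1 then 1 else 0 :=
    fun v _ => two_le_count_add h v
  have h1 := Finset.sum_le_sum hle
  have h2 := card_count_eq_one_le hT h
  have h3 : ∑ _v : V, 2 = 2 * Fintype.card V := by simp [mul_comm]
  rw [sum_count_add, h3] at h1
  -- Minimal length makes the summed inequality tight, hence tight at each letter.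
  have heq := (Finset.sum_eq_sum_iff_of_le hle).1 (by rw [sum_count_add, h3]; omega)
  obtain ⟨x, y, hxy, hset⟩ := Finset.card_eq_two.1
    (by omega : (Finset.univ.filter fun v => w.count v = 1).card = 2)
  have hone : ∀ v, w.count v = 1 ↔ v ∈ s(x, y) := by
    intro v
    rw [Sym2.mem_iff]
    simpa using Finset.ext_iff.1 hset v
  refine ⟨s(x, y), ?_, fun v => ?_, fun u _ v _ huv => h.2 u v huv⟩
  · exact (h.2 x y hxy).2 (alternate_of_count_eq_one hxy ((hone x).2 (by simp))
      ((hone y).2 (by simp)))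
  · rw [if_pos (Finset.mem_univ v)]
    have := heq v (Finset.mem_univ v)
    by_cases hv : v ∈ s(x, y)
    · rw [if_pos hv, (hone v).2 hv]
    · rw [if_neg hv]
      rw [if_neg (fun h => hv ((hone v).1 h))] at this
      omega

/-- The edge is recovered as the set of letters occurring once; this makes the classes of words for
different edges disjoint. -/
lemma IsRepOn.edge_unique {e e' : Sym2 V} {w : List V} (h : IsRepOn T e Finset.univ w)
    (h' : IsRepOn T e' Finset.univ w) : e = e' := by
  ext v
  have h1 := h.count_eq v
  rw [h'.count_eq v] at h1
  by_cases hv : v ∈ e <;> by_cases hv' : v ∈ e' <;> simp [hv, hv'] at h1 ⊢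

lemma exists_isRepOn [DecidableRel T.Adj] (hT : T.IsTree) {e : Sym2 V} (he : e ∈ T.edgeSet) :
    ∃ A : Finset (List V), (∀ w, w ∈ A ↔ IsRepOn T e Finset.univ w) ∧
      A.card = 2 * ∏ v, (inDegree T e Finset.univ v).factorial := by
  induction e with | _ x y
  obtain ⟨A, h1, h2, -⟩ := isCounted_univ hT (x := x) (y := y) he
  exact ⟨A, h1, h2⟩

lemma minLength_add_two [DecidableRel T.Adj] (hT : T.IsTree) (hV : 2 ≤ Fintype.card V) :
    minLength T + 2 = 2 * Fintype.card V := by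
  have : Nontrivial V := Fintype.one_lt_card_iff_nontrivial.1 hV
  obtain ⟨x⟩ := hT.connected.nonempty
  obtain ⟨y, hxy⟩ := hT.connected.preconnected.exists_adj_of_nontrivial x
  obtain ⟨A, hA, hcard⟩ := exists_isRepOn hT ((SimpleGraph.mem_edgeSet T).2 hxy)
  obtain ⟨w, hw⟩ : A.Nonempty := by
    rw [← Finset.card_pos, hcard]
    have : 0 < ∏ v, (inDegree T s(x, y) Finset.univ v).factorial :=
      Finset.prod_pos fun v _ => Nat.factorial_pos _
    omega
  have hw := (hA w).1 hw
  have hlen := hw.length_add_two hxy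
  -- Nonemptiness is needed for the infimum to be attained, as `sInf ∅ = 0` in `ℕ`.
  have hmem : w.length ∈ {k : ℕ | ∃ w : List V, Represents w T ∧ w.length = k} :=
    ⟨w, hw.represents, rfl⟩
  have hle : minLength T ≤ w.length := Nat.sInf_le hmem
  obtain ⟨w', hw', hlen'⟩ := Nat.sInf_mem ⟨_, hmem⟩
  have := hw'.two_mul_card_le hT.isAcyclic
  have hlen'' : w'.length = minLength T := hlen'
  omega

end Trees

end WordRep

theorem mainTheorem1 {V : Type*} [Fintype V] [DecidableEq V] (T : SimpleGraph V)
    [DecidableRel T.Adj] (hT : T.IsTree) (hV : 2 ≤ Fintype.card V) :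
    (WordRep.numMinRepresentants T : ℚ) =
      2 * (∏ v : V, ((T.degree v).factorial : ℚ)) *
        (∑ e ∈ T.edgeFinset, WordRep.edgeTerm T e) := by
  classical
  have hmin := WordRep.minLength_add_two hT hV
  have hex : ∀ e : Sym2 V, ∃ A : Finset (List V), e ∈ T.edgeSet →
      (∀ w, w ∈ A ↔ WordRep.IsRepOn T e Finset.univ w) ∧
        A.card = 2 * ∏ v, (WordRep.inDegree T e Finset.univ v).factorial := by
    intro e
    by_cases he : e ∈ T.edgeSet
    · obtain ⟨A, hA⟩ := WordRep.exists_isRepOn hT he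
      exact ⟨A, fun _ => hA⟩
    · exact ⟨∅, fun h => absurd h he⟩
  choose A hA using hex
  have hset : {w : List V | WordRep.Represents w T ∧ w.length = WordRep.minLength T} =
      (T.edgeFinset.biUnion A : Finset (List V)) := by
    ext w
    simp only [Set.mem_ofPred_eq, Finset.coe_biUnion, Set.mem_iUnion, Finset.mem_coe,
      SimpleGraph.mem_edgeFinset, exists_prop]
    constructor
    · rintro ⟨h, hlen⟩
      obtain ⟨e, he, hw⟩ := h.exists_isRepOn hT.isAcyclic (by omega)
      exact ⟨e, he, ((hA e he).1 w).2 hw⟩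
    · rintro ⟨e, he, hw⟩
      have hw := ((hA e he).1 w).1 hw
      have := hw.length_add_two he
      exact ⟨hw.represents, by omega⟩
  rw [WordRep.numMinRepresentants, hset, Set.ncard_coe_finset, Finset.card_biUnion,
    Nat.cast_sum, Finset.mul_sum]
  · refine Finset.sum_congr rfl fun e he => ?_
    have he := SimpleGraph.mem_edgeFinset.1 he
    rw [(hA e he).2, WordRep.two_mul_prod_inDegree he]
  · intro e he e' he' hne
    refine Finset.disjoint_left.2 fun w hw hw' => ?_
    exact hne ((((hA e (SimpleGraph.mem_edgeFinset.1 he)).1 w).1 hw).edge_unique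
      (((hA e' (SimpleGraph.mem_edgeFinset.1 he')).1 w).1 hw'))
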